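/- Let $C$ be a compact connected Riemann surface. Let $\{U_j\}$ be a finite covering of $C$ by coordinate discs, with biholomorphic maps $\varphi_j : U_j \to \mathbb{D} = \{|z|<1\}$. For $r \in (0,1]$ put $U_j^r = \varphi_j^{-1}(\{|z|<r\})$ and $\mathcal{U}^r = \{U_j^r\}_j$, and let $r_* \in (0,1)$ be such that $\mathcal{U}^r$ covers $C$ for all $r \in [r_*,1]$. A unitary flat line bundle $(E,h)$ on $C$ is a holomorphic line bundle with a Hermitian metric that has holomorphic frames $e_j$ over $U_j$ with $|e_j|_h = 1$ and $e_k = t_{jk} e_j$ on $U_j \cap U_k$, where the functions $t_{jk}$ are locally constant with values in $\mathrm{U}(1)$. Let $\mathrm{Pic}^0(C) = \check H^1(C, \mathrm{U}(1))$ be the group of isomorphism classes of unitary flat line bundles, with neutral element $\mathbb{1}$, the class of the trivial bundle. Its universal covering is $\check H^1(C,\mathbb{R}) \to \mathrm{Pic}^0(C)$, $[a_{jk}] \mapsto [e^{2\pi i a_{jk}}]$. Fix an inner product on $\check H^1(C,\mathbb{R})$ and let $d$ be the induced distance on $\mathrm{Pic}^0(C)$, that is, $d(E_1,E_2)$ is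 the infimum of $|\xi_1 - \xi_2|$ over all lifts $\xi_i$ of $E_i$. For holomorphic Čech cochains $u = (u_j)$, $u_j \in \Gamma(U_j^r, E)$, and $f = (f_{jk})$, $f_{jk} \in \Gamma(U_j^r \cap U_k^r, E)$, put $(\delta u)_{jk} = u_k - u_j$, $\|u\|_{L^\infty,\mathcal{U}^r} = \max_j \sup_{U_j^r} |u_j|_h$ and $\|f\|_{L^\infty,\mathcal{U}^r} = \max_{j,k} \sup_{U_j^r \cap U_k^r} |f_{jk}|_h$ (both in $[0,\infty]$), and let $\check B^1(\mathcal{U}^r,E)$ be the image of $\delta$. Then there is a constant $D_\infty > 0$, independent of $E$, $r_1$ and $r_2$, such that for every unitary flat line bundle $(E,h)$ on $C$, all $r_1, r_2$ with $r_* < r_2 < r_1 \le 1$, and every coboundary $f \in \check B^1(\mathcal{U}^{r_1}, E)$, there is a holomorphic $0$-cochain $v \in \check C^0(\mathcal{U}^{r_2}, E)$ such that $\delta v = f$ on $\mathcal{U}^{r_2}$ and $$\|v\|_{L^\infty,\mathcal{U}^{r_2}} \le \frac{D_\infty}{(r_1-r_2)^2\, d(\mathbb{1},E)}\, \|f\|_{L^\infty,\mathcal{U}^{r_1}}.$$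 If $E$ is trivial, so that $d(\mathbb{1},E) = 0$, the right-hand side is read as $+\infty$ if $f \neq 0$, and as $0$ if $f = 0$. -/

import Mathlib

open Set
open scoped Manifold ContDiff ENNReal

/-- A finite family of coordinate discs `φ j : U j ≃ 𝔻` (biholomorphic onto the open unit disc) of a
Riemann surface `C`, indexed by `ι`, with a radius `rStar ∈ (0, 1)` such that the concentric discs
`φ j ⁻¹ (𝔻_{rStar})` (hence those of every radius in `[rStar, 1]`) still cover `C`. -/
structure NestedCovering (C : Type*) [TopologicalSpace C] [ChartedSpace ℂ C] (ι : Type*) where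
  /-- the coordinate discs -/
  φ : ι → OpenPartialHomeomorph C ℂ
  holomorphic : ∀ j, φ j ∈ IsManifold.maximalAtlas 𝓘(ℂ) ω C
  target_eq : ∀ j, (φ j).target = Metric.ball (0 : ℂ) 1
  /-- the minimal radius -/
  rStar : ℝ
  rStar_pos : 0 < rStar
  rStar_lt_one : rStar < 1
  covers : ∀ x : C, ∃ j, x ∈ (φ j).source ∧ ‖φ j x‖ < rStar

namespace NestedCovering

variable {C : Type*} [TopologicalSpace C] [ChartedSpace ℂ C] {ι : Type*}

/-- The open set `U j ⊆ C`. -/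
def U (𝒰 : NestedCovering C ι) (j : ι) : Set C := (𝒰.φ j).source

/-- The concentric disc `U j ^ r = φ j ⁻¹ (𝔻_r)`. -/
def disc (𝒰 : NestedCovering C ι) (r : ℝ) (j : ι) : Set C :=
  {x | x ∈ 𝒰.U j ∧ ‖𝒰.φ j x‖ < r}

theorem disc_one (𝒰 : NestedCovering C ι) (j : ι) : 𝒰.disc 1 j = 𝒰.U j := by
  ext x
  refine ⟨fun h => h.1, fun h => ⟨h, ?_⟩⟩
  have := (𝒰.φ j).map_source h
  rw [𝒰.target_eq] at this
  simpa using this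

/-! ### Locally constant Čech cochains of the covering `U` -/

/-- Čech `0`-cochains of `U` in the sheaf of locally constant `A`-valued functions. -/
abbrev LC0 (𝒰 : NestedCovering C ι) (A : Type*) := ∀ j : ι, LocallyConstant (𝒰.U j) A

/-- Čech `1`-cochains of `U` in the sheaf of locally constant `A`-valued functions. -/
abbrev LC1 (𝒰 : NestedCovering C ι) (A : Type*) :=
  ∀ j k : ι, LocallyConstant (𝒰.U j ∩ 𝒰.U k : Set C) A

/-- `Z¹(U, ℝ)`: cocycles `a j k + a k l = a j l` on triple intersections. -/
def Z1Real (𝒰 : NestedCovering C ι) : Submodule ℝ (𝒰.LC1 ℝ) where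
  carrier := {a | ∀ (j k l : ι) (x : C) (hj : x ∈ 𝒰.U j) (hk : x ∈ 𝒰.U k) (hl : x ∈ 𝒰.U l),
    a j k ⟨x, hj, hk⟩ + a k l ⟨x, hk, hl⟩ = a j l ⟨x, hj, hl⟩}
  zero_mem' := by intro j k l x hj hk hl; simp
  add_mem' := by
    intro a b ha hb j k l x hj hk hl
    simp only [Pi.add_apply, LocallyConstant.add_apply]
    rw [← ha j k l x hj hk hl, ← hb j k l x hj hk hl]; ring
  smul_mem' := by
    intro c a ha j k l x hj hk hl
    simp only [Pi.smul_apply, LocallyConstant.smul_apply, smul_eq_mul]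
    rw [← ha j k l x hj hk hl]; ring

/-- `B¹(U, ℝ)`: coboundaries `a j k = b k - b j`. -/
def B1Real (𝒰 : NestedCovering C ι) : Submodule ℝ 𝒰.Z1Real where
  carrier := {a | ∃ b : 𝒰.LC0 ℝ, ∀ (j k : ι) (x : C) (hj : x ∈ 𝒰.U j) (hk : x ∈ 𝒰.U k),
    a.1 j k ⟨x, hj, hk⟩ = b k ⟨x, hk⟩ - b j ⟨x, hj⟩}
  zero_mem' := ⟨0, by intro j k x hj hk; simp⟩
  add_mem' := by
    rintro a a' ⟨b, hb⟩ ⟨b', hb'⟩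
    refine ⟨b + b', fun j k x hj hk => ?_⟩
    simp only [Submodule.coe_add, Pi.add_apply, LocallyConstant.add_apply]
    rw [hb j k x hj hk, hb' j k x hj hk]; ring
  smul_mem' := by
    rintro c a ⟨b, hb⟩
    refine ⟨c • b, fun j k x hj hk => ?_⟩
    simp only [Submodule.coe_smul, Pi.smul_apply, LocallyConstant.smul_apply, smul_eq_mul]
    rw [hb j k x hj hk]; ring

/-- `H¹(U, ℝ)`. As the sets `U j` are discs this is `H¹(C, ℝ)`, the universal covering group of
`Pic⁰(C)`. -/
abbrev H1Real (𝒰 : NestedCovering C ι) := 𝒰.Z1Real ⧸ 𝒰.B1Real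

/-- `Z¹(U, U(1))`: cocycles `t j k * t k l = t j l` on triple intersections. -/
def Z1Unitary (𝒰 : NestedCovering C ι) : Subgroup (𝒰.LC1 Circle) where
  carrier := {t | ∀ (j k l : ι) (x : C) (hj : x ∈ 𝒰.U j) (hk : x ∈ 𝒰.U k) (hl : x ∈ 𝒰.U l),
    t j k ⟨x, hj, hk⟩ * t k l ⟨x, hk, hl⟩ = t j l ⟨x, hj, hl⟩}
  one_mem' := by intro j k l x hj hk hl; simp
  mul_mem' := by
    intro a b ha hb j k l x hj hk hl
    simp only [Pi.mul_apply, LocallyConstant.mul_apply]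
    rw [← ha j k l x hj hk hl, ← hb j k l x hj hk hl, mul_mul_mul_comm]
  inv_mem' := by
    intro a ha j k l x hj hk hl
    simp only [Pi.inv_apply, LocallyConstant.inv_apply]
    rw [← ha j k l x hj hk hl, mul_inv]

/-- `B¹(U, U(1))`: coboundaries `t j k = c k / c j`. -/
def B1Unitary (𝒰 : NestedCovering C ι) : Subgroup 𝒰.Z1Unitary where
  carrier := {t | ∃ c : 𝒰.LC0 Circle, ∀ (j k : ι) (x : C) (hj : x ∈ 𝒰.U j) (hk : x ∈ 𝒰.U k),
    t.1 j k ⟨x, hj, hk⟩ = c k ⟨x, hk⟩ / c j ⟨x, hj⟩}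
  one_mem' := ⟨1, by intro j k x hj hk; simp⟩
  mul_mem' := by
    rintro a a' ⟨b, hb⟩ ⟨b', hb'⟩
    refine ⟨b * b', fun j k x hj hk => ?_⟩
    simp only [Subgroup.coe_mul, Pi.mul_apply, LocallyConstant.mul_apply]
    rw [hb j k x hj hk, hb' j k x hj hk, div_mul_div_comm]
  inv_mem' := by
    rintro a ⟨b, hb⟩
    refine ⟨b⁻¹, fun j k x hj hk => ?_⟩
    simp only [Subgroup.coe_inv, Pi.inv_apply, LocallyConstant.inv_apply]
    rw [hb j k x hj hk, inv_div_inv, inv_div]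

/-- A unitary flat line bundle `(E, h)` on `C`, given by its transition functions: the bundle has
a flat frame `e j` with `|e j|_h = 1` over each disc `U j`, and `e k = t j k • e j` over
`U j ∩ U k` with `t j k` locally constant of modulus one. -/
abbrev UnitaryFlatLineBundle (𝒰 : NestedCovering C ι) := 𝒰.Z1Unitary

/-- `Pic⁰(C) = H¹(U, U(1))`: the group of isomorphism classes of unitary flat line bundles; its
neutral element is the class of the trivial bundle. -/
abbrev Pic0 (𝒰 : NestedCovering C ι) := 𝒰.Z1Unitary ⧸ 𝒰.B1Unitary

/-- The map `t ↦ exp (2πi t)` from `ℝ` to `U(1)`. -/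
noncomputable def expCircle (t : ℝ) : Circle := Circle.exp (2 * Real.pi * t)

/-- `exp (2πi ·)` on cocycles. -/
noncomputable def expZ1 (𝒰 : NestedCovering C ι) (a : 𝒰.Z1Real) : 𝒰.Z1Unitary :=
  ⟨fun j k => (a.1 j k).map expCircle, by
    intro j k l x hj hk hl
    simp only [LocallyConstant.map_apply, Function.comp_apply, expCircle]
    rw [← a.2 j k l x hj hk hl, mul_add, Circle.exp_add]⟩

/-- The covering homomorphism `H¹(C, ℝ) → Pic⁰(C)` induced by `exp (2πi ·)`. -/
noncomputable def expH1 (𝒰 : NestedCovering C ι) : 𝒰.H1Real → 𝒰.Pic0 :=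
  Quotient.lift (fun a : 𝒰.Z1Real => (QuotientGroup.mk (𝒰.expZ1 a) : 𝒰.Pic0)) (by
    intro a b hab
    rw [← Quotient.eq_iff_equiv, Quotient.eq, Submodule.quotientRel_def] at hab
    obtain ⟨c, hc⟩ := hab
    refine QuotientGroup.eq.2 ⟨fun j => (-c j).map expCircle, fun j k x hj hk => ?_⟩
    have h : b.1 j k ⟨x, hj, hk⟩ = a.1 j k ⟨x, hj, hk⟩ - (c k ⟨x, hk⟩ - c j ⟨x, hj⟩) := by
      rw [← hc j k x hj hk]
      change _ = _ - (a.1 j k ⟨x, hj, hk⟩ - b.1 j k ⟨x, hj, hk⟩)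
      ring
    simp only [expZ1, Subgroup.coe_mul, Subgroup.coe_inv, Pi.mul_apply, Pi.inv_apply,
      LocallyConstant.mul_apply, LocallyConstant.inv_apply, LocallyConstant.map_apply,
      Function.comp_apply, LocallyConstant.neg_apply, expCircle]
    rw [h, ← Circle.exp_neg, ← Circle.exp_add, ← Circle.exp_sub]
    congr 1
    ring)

theorem expH1_mk (𝒰 : NestedCovering C ι) (a : 𝒰.Z1Real) :
    𝒰.expH1 (Submodule.Quotient.mk a) = QuotientGroup.mk (𝒰.expZ1 a) := rfl

/-- The distance on `Pic⁰(C)` induced from the Euclidean distance, given by an inner product, on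
the universal covering space `H¹(C, ℝ)`: the least distance between points of the two fibres of the
covering homomorphism. (The fibres are non-empty, every unitary flat class being in its image when
`C` is a compact Riemann surface.) -/
noncomputable def euclideanDist (𝒰 : NestedCovering C ι) (euc : InnerProductSpace.Core ℝ 𝒰.H1Real)
    (E₁ E₂ : 𝒰.Pic0) : ℝ :=
  sInf {d : ℝ | ∃ ξ₁ ξ₂ : 𝒰.H1Real, 𝒰.expH1 ξ₁ = E₁ ∧ 𝒰.expH1 ξ₂ = E₂ ∧
    d = Real.sqrt (euc.inner (ξ₁ - ξ₂) (ξ₁ - ξ₂))}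

/-! ### Holomorphic Čech cochains with values in a unitary flat line bundle

The section `u j` of `E` over `U j ^ r` is given by its coefficient with respect to the unit frame
`e j`, and `f j k` over `U j ^ r ∩ U k ^ r` by its coefficient with respect to `e j`, so that the
pointwise norms are `|u j|` and `|f j k|`. Values outside these sets are irrelevant. -/

/-- `u` is a holomorphic `0`-cochain of the covering `{U j ^ r}`. -/
def IsCochain0 (𝒰 : NestedCovering C ι) (r : ℝ) (u : ι → C → ℂ) : Prop :=
  ∀ j, MDifferentiableOn 𝓘(ℂ) 𝓘(ℂ) (u j) (𝒰.disc r j)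

/-- `δ u = f` on the covering `{U j ^ r}`: the section `u k - u j` of `E` is `f j k`. -/
def DeltaEq (𝒰 : NestedCovering C ι) (E : 𝒰.UnitaryFlatLineBundle) (r : ℝ)
    (u : ι → C → ℂ) (f : ι → ι → C → ℂ) : Prop :=
  ∀ (j k : ι) (x : C) (hj : x ∈ 𝒰.disc r j) (hk : x ∈ 𝒰.disc r k),
    ((E.1 j k ⟨x, hj.1, hk.1⟩ : Circle) : ℂ) * u k x - u j x = f j k x

/-- `f ∈ B¹({U j ^ r}, E)`. -/
def IsCoboundary (𝒰 : NestedCovering C ι) (E : 𝒰.UnitaryFlatLineBundle) (r : ℝ)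
    (f : ι → ι → C → ℂ) : Prop :=
  ∃ u : ι → C → ℂ, 𝒰.IsCochain0 r u ∧ 𝒰.DeltaEq E r u f

/-- `max_j sup_{U j ^ r} |u j|_h`, with values in `[0, ∞]`. -/
noncomputable def supNorm0 (𝒰 : NestedCovering C ι) (r : ℝ) (u : ι → C → ℂ) : ℝ≥0∞ :=
  ⨆ j, ⨆ x ∈ 𝒰.disc r j, ‖u j x‖ₑ

/-- `max_{j, k} sup_{U j ^ r ∩ U k ^ r} |f j k|_h`, with values in `[0, ∞]`. -/
noncomputable def supNorm1 (𝒰 : NestedCovering C ι) (r : ℝ) (f : ι → ι → C → ℂ) : ℝ≥0∞ :=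
  ⨆ j, ⨆ k, ⨆ x ∈ 𝒰.disc r j ∩ 𝒰.disc r k, ‖f j k x‖ₑ

end NestedCovering

/-!
The proof is elementary: it uses the Schwarz lemma, compactness and linear algebra over `ℚ`, and
gives a constant without any dependence on `r₁ - r₂`, which is at most `1`.

*Analysis.* Let `u` be a holomorphic cochain with values in `E` whose coboundary is bounded by `ε`,
and let `M` be the maximum of `|u|` on the discs of radius `rStar`. The functions `|u j|` agree up to
`ε` on overlaps, so `M` is attained up to `ε` on one of the discs of a radius `r < rStar` that still
cover `C`. Harnack's inequality, applied to the function `M + ε - conj c * u j` with positive real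
part, shows that `u j` is `O(ε)`-close to a constant `M c` with `|c| = 1` on that disc
(`Complex.exists_norm_sub_const_le`). Then the modulus is nearly maximal on all discs that meet it,
and since `C` is connected this spreads to the whole covering (`exists_norm_sub_frame_le`): there are
constants `g j` of modulus one with `u j = M g j + O(ε)`. Hence
`M |t j k * g k - g j| = O(ε)` on the overlaps. The point is that Harnack's inequality loses
only a constant factor, so that the estimate remains linear in `ε`.

*Algebra.* It remains to see that `d(1, E) ≤ c s` if a change of frames by constants makes the
transition functions `s`-close to `1` on the overlaps of the compact discs of radius `r`
(`exists_euclideanDist_le`). On these overlaps locally constant functions are determined by their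
values at a finite set `P` of points, and a cocycle that is trivial there is a coboundary by gluing
(`exists_coboundary_of_eq_one`). So real cocycles are described by a subspace `W` of `ℝ^P`, and those
with integer values on `P` represent the trivial bundle. Applying `ℚ`-linear functionals `ℝ → ℚ` to
the values of a cocycle shows that `W` is spanned by its integer vectors, and for such a subspace
a vector of `W` near an integer vector is proportionally near to an integer vector of `W`
(`Submodule.exists_int_dist_le`). In particular `d(1, E)` is bounded.

Together, `d(1, E) M = O(ε)`, and `|u| ≤ M + ε` on all discs of radius less than `r₁`; so the given
primitive `u` of `f` is itself the required cochain when `E` is not trivial.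
-/

/-! ### Locally constant functions and connected covers -/

/-- On a compact set locally constant functions are determined by their values at finitely many of
its points, because finitely many connected components, which are open, cover the set. -/
theorem IsCompact.exists_finset_locallyConstant {X : Type*} [TopologicalSpace X]
    [LocallyConnectedSpace X] {K : Set X} (hK : IsCompact K) :
    ∃ F : Finset X, (∀ p ∈ F, p ∈ K) ∧ ∀ x ∈ K, ∃ p ∈ F, ∀ (A : Type) (f : LocallyConstant X A),
      f x = f p := by
  obtain ⟨F, hF, hcov⟩ := hK.elim_nhds_subcover (fun x => connectedComponent x)
    (fun x _ => isOpen_connectedComponent.mem_nhds mem_connectedComponent)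
  refine ⟨F, hF, fun x hx => ?_⟩
  obtain ⟨p, hp, hxp⟩ := mem_iUnion₂.1 (hcov hx)
  exact ⟨p, hp, fun A f => f.isLocallyConstant.apply_eq_of_isPreconnected
    isPreconnected_connectedComponent hxp mem_connectedComponent⟩

theorem LocallyConstant.eventually_eq_subtype {X A : Type*} [TopologicalSpace X] {S : Set X}
    (f : LocallyConstant S A) {x : X} (hx : x ∈ S) :
    ∀ᶠ y in nhds x, ∀ hy : y ∈ S, f ⟨y, hy⟩ = f ⟨x, hx⟩ := by
  have h := (IsLocallyConstant.iff_eventually_eq f).1 f.isLocallyConstant ⟨x, hx⟩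
  rw [nhds_subtype_eq_comap, Filter.eventually_comap] at h
  filter_upwards [h] with y hy hyS using hy ⟨y, hyS⟩ rfl

/-- A finite closed cover of a connected space by nonempty sets has a connected nerve: a property
that passes between intersecting members and holds for one of them holds for all. -/
theorem forall_of_closed_cover {X ι : Type*} [TopologicalSpace X]
    [PreconnectedSpace X] [Finite ι] {K : ι → Set X} (hK : ∀ j, IsClosed (K j))
    (hne : ∀ j, (K j).Nonempty) (hcov : ∀ x, ∃ j, x ∈ K j) {p : ι → Prop} {j₀ : ι} (h₀ : p j₀)
    (hp : ∀ j, p j → ∀ k, (K j ∩ K k).Nonempty → p k) : ∀ k, p k := by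
  by_contra! ⟨k, hk⟩
  set S : Set ι := {j | p j}
  have h1 : IsClosed (⋃ j ∈ S, K j) := S.toFinite.isClosed_biUnion fun j _ => hK j
  have h2 : IsClosed (⋃ j ∈ Sᶜ, K j) := Sᶜ.toFinite.isClosed_biUnion fun j _ => hK j
  have h := isPreconnected_closed_iff.1 (isPreconnected_univ (α := X)) _ _ h1 h2
    (fun x _ => by
      obtain ⟨j, hj⟩ := hcov x
      by_cases hjS : j ∈ S
      · exact Or.inl (mem_biUnion hjS hj)
      · exact Or.inr (mem_biUnion (show j ∈ Sᶜ from hjS) hj))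
    (by
      obtain ⟨x, hx⟩ := hne j₀
      exact ⟨x, mem_univ _, mem_biUnion (show j₀ ∈ S from h₀) hx⟩)
    (by
      obtain ⟨x, hx⟩ := hne k
      exact ⟨x, mem_univ _, mem_biUnion (show k ∈ Sᶜ from hk) hx⟩)
  obtain ⟨x, -, hx1, hx2⟩ := h
  obtain ⟨j, hj, hxj⟩ := mem_iUnion₂.1 hx1
  obtain ⟨l, hl, hxl⟩ := mem_iUnion₂.1 hx2
  exact hl (hp j hj l ⟨x, hxj, hxl⟩)

/-! ### Concentric discs and gluing of locally constant cocycles -/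

namespace NestedCovering

variable {C : Type*} [TopologicalSpace C] [ChartedSpace ℂ C] {ι : Type*}

/-- The closed concentric disc `{x ∈ U j | |φ j x| ≤ r}`; it is compact when `r < 1`. -/
def closedDisc (𝒰 : NestedCovering C ι) (r : ℝ) (j : ι) : Set C :=
  {x | x ∈ 𝒰.U j ∧ ‖𝒰.φ j x‖ ≤ r}

theorem disc_subset_closedDisc (𝒰 : NestedCovering C ι) (r : ℝ) (j : ι) :
    𝒰.disc r j ⊆ 𝒰.closedDisc r j := fun _ hx => ⟨hx.1, hx.2.le⟩

theorem closedDisc_subset_disc (𝒰 : NestedCovering C ι) {r s : ℝ} (h : r < s) (j : ι) :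
    𝒰.closedDisc r j ⊆ 𝒰.disc s j := fun _ hx => ⟨hx.1, hx.2.trans_lt h⟩

theorem disc_mono (𝒰 : NestedCovering C ι) {r s : ℝ} (h : r ≤ s) (j : ι) :
    𝒰.disc r j ⊆ 𝒰.disc s j := fun _ hx => ⟨hx.1, hx.2.trans_le h⟩

theorem isOpen_U (𝒰 : NestedCovering C ι) (j : ι) : IsOpen (𝒰.U j) := (𝒰.φ j).open_source

theorem isOpen_disc (𝒰 : NestedCovering C ι) (r : ℝ) (j : ι) : IsOpen (𝒰.disc r j) := by
  have := (𝒰.φ j).isOpen_inter_preimage (s := Metric.ball 0 r) Metric.isOpen_ball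
  convert this using 1
  ext x
  simp [disc, U]

theorem closedDisc_eq_image (𝒰 : NestedCovering C ι) {r : ℝ} (hr : r < 1) (j : ι) :
    𝒰.closedDisc r j = (𝒰.φ j).symm '' Metric.closedBall 0 r := by
  have hsub : Metric.closedBall (0 : ℂ) r ⊆ (𝒰.φ j).target := by
    rw [𝒰.target_eq]
    exact Metric.closedBall_subset_ball hr
  ext x
  constructor
  · rintro ⟨hx, hxr⟩
    exact ⟨𝒰.φ j x, by simpa using hxr, (𝒰.φ j).left_inv hx⟩
  · rintro ⟨z, hz, rfl⟩
    refine ⟨(𝒰.φ j).map_target (hsub hz), ?_⟩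
    rw [(𝒰.φ j).right_inv (hsub hz)]
    simpa using hz

theorem isCompact_closedDisc (𝒰 : NestedCovering C ι) {r : ℝ} (hr : r < 1) (j : ι) :
    IsCompact (𝒰.closedDisc r j) := by
  rw [𝒰.closedDisc_eq_image hr]
  refine (isCompact_closedBall (0 : ℂ) r).image_of_continuousOn
    ((𝒰.φ j).continuousOn_symm.mono ?_)
  rw [𝒰.target_eq]
  exact Metric.closedBall_subset_ball hr

theorem closedDisc_nonempty (𝒰 : NestedCovering C ι) {r : ℝ} (h0 : 0 ≤ r) (hr : r < 1) (j : ι) :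
    (𝒰.closedDisc r j).Nonempty := by
  rw [𝒰.closedDisc_eq_image hr]
  exact ⟨_, 0, by simpa using h0, rfl⟩

/-- By compactness, discs of some radius smaller than `rStar` already cover `C`. -/
theorem exists_radius_lt_covers [CompactSpace C] [Nonempty C] (𝒰 : NestedCovering C ι) :
    ∃ r, 0 < r ∧ r < 𝒰.rStar ∧ ∀ x : C, ∃ j, x ∈ 𝒰.disc r j := by
  have hdir : Directed (· ⊆ ·) fun s : Ioo 0 𝒰.rStar => ⋃ j, 𝒰.disc s j :=
    Monotone.directed_le fun s t hst => iUnion_mono fun j => 𝒰.disc_mono hst j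
  have : Nonempty (Ioo 0 𝒰.rStar) := nonempty_Ioo_subtype 𝒰.rStar_pos
  obtain ⟨s, hs⟩ := (isCompact_univ (X := C)).elim_directed_cover _
    (fun s : Ioo 0 𝒰.rStar => isOpen_iUnion fun j => 𝒰.isOpen_disc s j)
    (fun x _ => by
      obtain ⟨j, hj, hjr⟩ := 𝒰.covers x
      obtain ⟨s, hs1, hs2⟩ := exists_between hjr
      exact mem_iUnion.2 ⟨⟨s, (norm_nonneg _).trans_lt hs1, hs2⟩, mem_iUnion.2 ⟨j, hj, hs1⟩⟩)
    hdir
  exact ⟨s, s.2.1, s.2.2, fun x => mem_iUnion.1 (hs (mem_univ x))⟩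

/-- Gluing: a locally constant cocycle of the covering `U` that is trivial on the overlaps of
smaller discs which still cover `C` is a coboundary. At `x ∈ U j` the value of the
primitive is read off from any small disc `l` containing `x`. -/
@[to_additive /-- Gluing: a locally constant cocycle of the covering `U` that vanishes on the
overlaps of smaller discs which still cover `C` is a coboundary. -/]
theorem exists_coboundary_of_eq_one {A : Type*} [CommGroup A] (𝒰 : NestedCovering C ι)
    {r : ℝ} (hcov : ∀ x : C, ∃ j, x ∈ 𝒰.disc r j) (a : 𝒰.LC1 A)
    (ha : ∀ (j k l : ι) (x : C) (hj : x ∈ 𝒰.U j) (hk : x ∈ 𝒰.U k) (hl : x ∈ 𝒰.U l),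
      a j k ⟨x, hj, hk⟩ * a k l ⟨x, hk, hl⟩ = a j l ⟨x, hj, hl⟩)
    (h1 : ∀ (j k : ι) (x : C) (hj : x ∈ 𝒰.disc r j) (hk : x ∈ 𝒰.disc r k),
      a j k ⟨x, hj.1, hk.1⟩ = 1) :
    ∃ b : 𝒰.LC0 A, ∀ (j k : ι) (x : C) (hj : x ∈ 𝒰.U j) (hk : x ∈ 𝒰.U k),
      a j k ⟨x, hj, hk⟩ = b k ⟨x, hk⟩ / b j ⟨x, hj⟩ := by
  choose l hl using hcov
  -- The value does not depend on the small disc from which it is read off.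
  have key : ∀ (j m : ι) (x : C) (hj : x ∈ 𝒰.U j) (hm : x ∈ 𝒰.disc r m),
      a j (l x) ⟨x, hj, (hl x).1⟩ = a j m ⟨x, hj, hm.1⟩ := fun j m x hj hm => by
    rw [← ha j m (l x) x hj hm.1 (hl x).1, h1 m (l x) x hm (hl x), mul_one]
  refine ⟨fun j => ⟨fun x => (a j (l x) ⟨x, x.2, (hl x).1⟩)⁻¹, ?_⟩, fun j k x hj hk => ?_⟩
  · rw [IsLocallyConstant.iff_eventually_eq]
    rintro ⟨x, hx⟩
    rw [nhds_subtype_eq_comap, Filter.eventually_comap]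
    filter_upwards [(a j (l x)).eventually_eq_subtype ⟨hx, (hl x).1⟩,
      (𝒰.isOpen_disc r (l x)).mem_nhds (hl x)] with y hy hyd
    rintro ⟨y', hy'⟩ rfl
    simp only
    rw [key j (l x) y' hy' hyd, hy ⟨hy', hyd.1⟩]
  · simp only [LocallyConstant.coe_mk]
    rw [← ha j k (l x) x hj hk (hl x).1]
    simp

end NestedCovering

/-! ### Integer vectors in subspaces of `ℝ^P` -/

/-- In a real subspace `W` of `ℝ^P` that is spanned by its integer vectors, a vector of `W` close to
an integer vector is proportionally close to an integer vector of `W`: translating by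
integer vectors of `W` leaves finitely many integer vectors to consider, and those outside
`W` have positive distance to it. -/
theorem Submodule.exists_int_dist_le {P : Type*} [Fintype P] (W : Submodule ℝ (P → ℝ))
    (hW : W ≤ Submodule.span ℝ {w | w ∈ W ∧ ∃ n : P → ℤ, w = fun p => (n p : ℝ)}) :
    ∃ c : ℝ, 0 ≤ c ∧ ∀ w ∈ W, ∀ n : P → ℤ, ∃ m : P → ℤ, (fun p => (m p : ℝ)) ∈ W ∧
      ‖w - fun p => (m p : ℝ)‖ ≤ c * ‖w - fun p => (n p : ℝ)‖ := by
  obtain ⟨b, hbL, hspan, hli⟩ :=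
    exists_linearIndependent ℝ {w : P → ℝ | w ∈ W ∧ ∃ n : P → ℤ, w = fun p => (n p : ℝ)}
  have hbfin : b.Finite := hli.setFinite
  obtain ⟨s, rfl⟩ := hbfin.exists_finset_coe
  rw [← hspan] at hW
  -- Rounding down coefficients brings every vector of `W` into a bounded region.
  have hred : ∀ w ∈ W, ∃ m : P → ℤ, (fun p => (m p : ℝ)) ∈ W ∧
      ‖w - fun p => (m p : ℝ)‖ ≤ ∑ v ∈ s, ‖v‖ := by
    intro w hw
    obtain ⟨c, -, hc⟩ := Submodule.mem_span_finset.1 (hW hw)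
    have hint : ∀ v : P → ℝ, ∃ n : P → ℤ, v ∈ s → v = fun p => (n p : ℝ) := fun v => by
      by_cases hv : v ∈ s
      · obtain ⟨n, hn⟩ := (hbL hv).2
        exact ⟨n, fun _ => hn⟩
      · exact ⟨0, fun h => absurd h hv⟩
    choose n hn using hint
    have hm : (fun p => ((∑ v ∈ s, ⌊c v⌋ * n v p : ℤ) : ℝ)) = ∑ v ∈ s, (⌊c v⌋ : ℝ) • v := by
      funext p
      push_cast
      rw [Finset.sum_apply]
      refine Finset.sum_congr rfl fun v hv => ?_
      rw [Pi.smul_apply, smul_eq_mul, ← congrFun (hn v hv) p]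
    refine ⟨fun p => ∑ v ∈ s, ⌊c v⌋ * n v p, ?_, ?_⟩
    · rw [hm]
      exact W.sum_mem fun v hv => W.smul_mem _ (hbL hv).1
    · rw [hm, ← hc, ← Finset.sum_sub_distrib]
      refine norm_sum_le_of_le _ fun v _ => ?_
      rw [← sub_smul, norm_smul, Real.norm_eq_abs, Int.self_sub_floor, Int.abs_fract]
      exact mul_le_of_le_one_left (norm_nonneg _) (Int.fract_lt_one _).le
  set R := ∑ v ∈ s, ‖v‖ with hR
  have hR0 : 0 ≤ R := Finset.sum_nonneg fun v _ => norm_nonneg v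
  classical
  -- The integer vectors outside `W` that matter after this reduction are finite in number.
  have hF : {x : P → ℝ | x ∉ W ∧ ‖x‖ ≤ R + 1 ∧ ∃ n : P → ℤ, x = fun p => (n p : ℝ)}.Finite := by
    refine ((Set.finite_Icc (fun _ : P => -⌈R + 1⌉) (fun _ => ⌈R + 1⌉)).image
      (fun n p => (n p : ℝ))).subset ?_
    rintro x ⟨-, hx, n, rfl⟩
    have h := fun p => abs_le.1 ((norm_le_pi_norm (fun p => (n p : ℝ)) p).trans hx)
    refine ⟨n, ⟨fun p => ?_, fun p => ?_⟩, rfl⟩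
    · have := (h p).1
      have h2 := Int.le_ceil (R + 1)
      exact_mod_cast (by push_cast; linarith : ((-⌈R + 1⌉ : ℤ) : ℝ) ≤ n p)
    · exact_mod_cast (h p).2.trans (Int.le_ceil (R + 1))
  obtain ⟨δ, hδ, hsep⟩ := Metric.exists_pos_forall_lt_edist hF.isCompact
    W.closed_of_finiteDimensional (disjoint_left.2 fun x hx hxW => hx.1 hxW)
  set δ' : ℝ := min δ 1 with hδ'
  have hδ'0 : 0 < δ' := lt_min hδ one_pos
  refine ⟨R / δ' + 1, by positivity, fun w hw n => ?_⟩
  obtain ⟨m, hm, hwm⟩ := hred w hw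
  set N : (P → ℤ) → P → ℝ := fun n p => (n p : ℝ) with hN
  -- Either the reduction `m` of `w` will do, or `n` itself lies in `W`.
  rcases le_or_gt δ' ‖w - N n‖ with h | h
  · refine ⟨m, hm, hwm.trans ?_⟩
    calc R = R / δ' * δ' := by field_simp
      _ ≤ R / δ' * ‖w - N n‖ := by gcongr
      _ ≤ _ := by nlinarith [norm_nonneg (w - N n)]
  · refine ⟨n, ?_, ?_⟩
    · by_contra hnW
      have hsub : N (n - m) = N n - N m := by funext p; simp [hN]
      have hx : N (n - m) ∈ {x : P → ℝ | x ∉ W ∧ ‖x‖ ≤ R + 1 ∧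
          ∃ n : P → ℤ, x = fun p => (n p : ℝ)} := by
        refine ⟨fun hmem => hnW ?_, ?_, n - m, rfl⟩
        · have := W.add_mem hmem hm
          rwa [hsub, sub_add_cancel] at this
        · rw [hsub, show N n - N m = (w - N m) - (w - N n) by abel]
          refine (norm_sub_le _ _).trans (add_le_add hwm (h.le.trans (min_le_right _ _)))
      have hlt := hsep _ hx (w - N m) (W.sub_mem hw hm)
      rw [edist_comm, edist_eq_enorm_sub, hsub, sub_sub_sub_cancel_right,
        ← ENNReal.ofReal_coe_nnreal, ← ofReal_norm] at hlt
      have hlt' := (ENNReal.ofReal_lt_ofReal_iff_of_nonneg δ.coe_nonneg).1 hlt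
      exact absurd (hlt'.trans h) (not_lt.2 (min_le_left _ _))
    · exact le_mul_of_one_le_left (norm_nonneg _) (by linarith [div_nonneg hR0 hδ'0.le])

/-- A finite family of real numbers `v` is a real linear combination of integer-valued families of the
form `μ ∘ v` with `μ : ℝ → ℝ` additive: such `μ` are obtained from the coordinates with respect to
a basis of the `ℚ`-span of the family, extended to `ℝ` and multiplied by a common denominator. -/
theorem exists_integral_functionals {P : Type*} [Finite P] (v : P → ℝ) :
    ∃ (d : ℕ) (β : Fin d → ℝ) (μ : Fin d → ℝ →+ ℝ), (∀ i p, ∃ n : ℤ, μ i (v p) = n) ∧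
      ∀ p, v p = ∑ i, β i * μ i (v p) := by
  cases nonempty_fintype P
  set V := Submodule.span ℚ (range v) with hV
  have : FiniteDimensional ℚ V := FiniteDimensional.span_of_finite ℚ (finite_range v)
  obtain ⟨π, hπ⟩ := V.subtype.exists_leftInverse_of_injective V.ker_subtype
  set b := Module.finBasis ℚ V
  have hmem : ∀ p, v p ∈ V := fun p => Submodule.subset_span (mem_range_self p)
  have hπv : ∀ p, π (v p) = ⟨v p, hmem p⟩ := fun p => by
    simpa using LinearMap.congr_fun hπ ⟨v p, hmem p⟩
  set q : Fin (Module.finrank ℚ V) → ℝ → ℚ := fun i x => b.repr (π x) i with hq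
  set N : Fin (Module.finrank ℚ V) → ℕ := fun i => ∏ p, (q i (v p)).den with hN
  have hN0 : ∀ i, (N i : ℝ) ≠ 0 := fun i => by
    rw [hN]
    exact_mod_cast (Finset.prod_pos fun p _ => (q i (v p)).pos).ne'
  refine ⟨Module.finrank ℚ V, fun i => (b i : ℝ) / N i,
    fun i => AddMonoidHom.mk' (fun x => (N i : ℝ) * (q i x : ℚ)) fun x y => ?_,
    fun i p => ?_, fun p => ?_⟩
  · simp [hq, mul_add]
  · obtain ⟨k, hk⟩ : (q i (v p)).den ∣ N i := Finset.dvd_prod_of_mem _ (Finset.mem_univ p)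
    refine ⟨k * (q i (v p)).num, ?_⟩
    simp only [AddMonoidHom.mk'_apply]
    rw [hk]
    have h := Rat.mul_den_eq_num (q i (v p))
    have h' : ((q i (v p) : ℚ) : ℝ) * (q i (v p)).den = (q i (v p)).num := by exact_mod_cast h
    push_cast
    rw [← h']
    ring
  · have h := b.sum_repr (π (v p))
    rw [hπv] at h
    have h' := congrArg (Subtype.val) h
    simp only [Submodule.coe_sum, Submodule.coe_smul] at h'
    conv_lhs => rw [← h']
    refine Finset.sum_congr rfl fun i _ => ?_
    simp only [AddMonoidHom.mk'_apply, hq, hπv]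
    rw [Rat.smul_def]
    field_simp [hN0 i]

/-! ### Norms and exponentials -/

/-- A linear map out of `ℝ^P` is bounded for the norm of an inner product. -/
theorem InnerProductSpace.Core.exists_bound {P V : Type*} [Fintype P] [AddCommGroup V] [Module ℝ V]
    (euc : InnerProductSpace.Core ℝ V) (T : (P → ℝ) →ₗ[ℝ] V) :
    ∃ c : ℝ, 0 ≤ c ∧ ∀ x, Real.sqrt (euc.inner (T x) (T x)) ≤ c * ‖x‖ := by
  let : NormedAddCommGroup V := euc.toNormedAddCommGroup
  let : InnerProductSpace ℝ V := InnerProductSpace.ofCore euc.toCore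
  refine ⟨‖LinearMap.toContinuousLinearMap T‖, ContinuousLinearMap.opNorm_nonneg _, fun x => ?_⟩
  exact (LinearMap.toContinuousLinearMap T).le_opNorm x

/-- The distance of `exp (2πi y)` from `1` bounds the distance of `y` from an integer. -/
theorem exists_int_abs_sub_le (y : ℝ) :
    ∃ n : ℤ, |y - n| ≤ ‖((Circle.exp (2 * Real.pi * y) : Circle) : ℂ) - 1‖ := by
  refine ⟨round y, ?_⟩
  have h0 : |y - round y| ≤ 1 / 2 := abs_sub_round y
  have h1 : Circle.exp (2 * Real.pi * y) = Circle.exp (2 * Real.pi * (y - round y)) := by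
    rw [mul_sub, Circle.exp_sub, mul_comm _ ((round y : ℤ) : ℝ), Circle.exp_int_mul_two_pi, div_one]
  rw [h1, Circle.coe_exp, mul_comm _ Complex.I, Complex.norm_exp_I_mul_ofReal_sub_one]
  set x := y - round y
  rw [norm_mul, Real.norm_eq_abs, Real.norm_eq_abs, abs_two,
    show 2 * Real.pi * x / 2 = Real.pi * x by ring]
  have h2 : |Real.sin (Real.pi * x)| = Real.sin (Real.pi * |x|) := by
    rcases abs_cases x with ⟨h, hx⟩ | ⟨h, hx⟩
    · rw [h, abs_of_nonneg]
      exact Real.sin_nonneg_of_nonneg_of_le_pi (by positivity) (by nlinarith [Real.pi_pos, le_abs_self x])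
    · rw [h, mul_neg, Real.sin_neg, abs_of_nonpos]
      exact Real.sin_nonpos_of_nonpos_of_neg_pi_le (by nlinarith [Real.pi_pos])
        (by nlinarith [Real.pi_pos, neg_abs_le x])
  rw [h2]
  have h3 := Real.mul_le_sin (x := Real.pi * |x|) (by positivity) (by nlinarith [Real.pi_pos])
  have h4 : 2 / Real.pi * (Real.pi * |x|) = 2 * |x| := by field_simp
  linarith [abs_nonneg x]

theorem LinearMap.exists_comp_eq_of_ker_le_ker {K V V' V'' : Type*} [Field K] [AddCommGroup V]
    [Module K V] [AddCommGroup V'] [Module K V'] [AddCommGroup V''] [Module K V'']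
    (f : V →ₗ[K] V') (g : V →ₗ[K] V'') (h : LinearMap.ker f ≤ LinearMap.ker g) :
    ∃ T : V' →ₗ[K] V'', ∀ x, T (f x) = g x := by
  obtain ⟨T, hT⟩ := ((f.ker.liftQ g h).comp f.quotKerEquivRange.symm.toLinearMap).exists_extend
  refine ⟨T, fun x => ?_⟩
  have := LinearMap.congr_fun hT ⟨f x, LinearMap.mem_range_self f x⟩
  simpa [LinearMap.quotKerEquivRange_symm_apply_image] using this

/-! ### The distance to the trivial bundle -/

namespace NestedCovering

variable {C : Type*} [TopologicalSpace C] [ChartedSpace ℂ C] {ι : Type*}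

/-- The overlap of two open discs may have infinitely many components, but only finitely many of them
meet the compact overlap of the closed discs of radius `r < 1`. -/
theorem exists_finset_overlap [T2Space C] (𝒰 : NestedCovering C ι) {r : ℝ} (hr : r < 1)
    (j k : ι) : ∃ F : Finset (𝒰.U j ∩ 𝒰.U k : Set C),
      (∀ p ∈ F, (p : C) ∈ 𝒰.closedDisc r j ∧ (p : C) ∈ 𝒰.closedDisc r k) ∧
      ∀ (x : C) (hj : x ∈ 𝒰.closedDisc r j) (hk : x ∈ 𝒰.closedDisc r k), ∃ p ∈ F,
        ∀ (A : Type) (f : LocallyConstant (𝒰.U j ∩ 𝒰.U k : Set C) A),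
          f ⟨x, hj.1, hk.1⟩ = f p := by
  have : LocallyConnectedSpace C := ChartedSpace.locallyConnectedSpace ℂ C
  have : LocallyConnectedSpace (𝒰.U j ∩ 𝒰.U k : Set C) :=
    ((𝒰.isOpen_U j).inter (𝒰.isOpen_U k)).locallyConnectedSpace
  have hK : IsCompact ((↑) ⁻¹' (𝒰.closedDisc r j ∩ 𝒰.closedDisc r k) :
      Set (𝒰.U j ∩ 𝒰.U k : Set C)) := by
    have hsub : 𝒰.closedDisc r j ∩ 𝒰.closedDisc r k ⊆ 𝒰.U j ∩ 𝒰.U k :=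
      fun x hx => ⟨hx.1.1, hx.2.1⟩
    rw [Subtype.isCompact_iff, Subtype.image_preimage_coe, inter_eq_self_of_subset_right hsub]
    exact (𝒰.isCompact_closedDisc hr j).inter (𝒰.isCompact_closedDisc hr k)
  obtain ⟨F, hFK, hF⟩ := hK.exists_finset_locallyConstant
  exact ⟨F, hFK, fun x hj hk => hF ⟨x, hj.1, hk.1⟩ ⟨hj, hk⟩⟩

/-- The coboundary of a real locally constant `0`-cochain, as a cocycle. -/
def deltaReal (𝒰 : NestedCovering C ι) (b : 𝒰.LC0 ℝ) : 𝒰.Z1Real :=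
  ⟨fun j k => (b k).comap ⟨inclusion inter_subset_right, continuous_inclusion _⟩ -
      (b j).comap ⟨inclusion inter_subset_left, continuous_inclusion _⟩, by
    intro j k l x hj hk hl
    change b k ⟨x, hk⟩ - b j ⟨x, hj⟩ + (b l ⟨x, hl⟩ - b k ⟨x, hk⟩) = b l ⟨x, hl⟩ - b j ⟨x, hj⟩
    ring⟩

theorem deltaReal_mem (𝒰 : NestedCovering C ι) (b : 𝒰.LC0 ℝ) : 𝒰.deltaReal b ∈ 𝒰.B1Real :=
  ⟨b, fun _ _ _ _ _ => rfl⟩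

/-- An additive map `ℝ → ℝ`, continuous or not, acts on locally constant cocycles. -/
def mapZ1 (𝒰 : NestedCovering C ι) (μ : ℝ →+ ℝ) (a : 𝒰.Z1Real) : 𝒰.Z1Real :=
  ⟨fun j k => (a.1 j k).map μ, by
    intro j k l x hj hk hl
    simp only [LocallyConstant.map_apply, Function.comp_apply]
    rw [← a.2 j k l x hj hk hl, map_add]⟩

theorem expCircle_add (s t : ℝ) : expCircle (s + t) = expCircle s * expCircle t := by
  simp [expCircle, mul_add, Circle.exp_add]

theorem expCircle_sub (s t : ℝ) : expCircle (s - t) = expCircle s / expCircle t := by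
  simp [expCircle, mul_sub, Circle.exp_sub]

theorem expCircle_arg (z : Circle) : expCircle (Complex.arg z / (2 * Real.pi)) = z := by
  rw [expCircle, mul_div_cancel₀ _ (by positivity), Circle.exp_arg]

theorem expCircle_intCast (n : ℤ) : expCircle n = 1 := by
  rw [expCircle, mul_comm, Circle.exp_int_mul_two_pi]

/-- The distance of `Pic⁰` is controlled on overlaps of compact discs: if a change of the flat
frames `e j` by constants `g j` of modulus one makes the transition functions `s`-close to `1` there,
then the bundle is at distance `O(s)` from the trivial one. The real cocycles, evaluated at
finitely many points of the overlaps, form a subspace of a coordinate space that is spanned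
by integer vectors, and a cocycle that is integral at these points lies over the trivial bundle. -/
theorem exists_euclideanDist_le [T2Space C] [Finite ι] (𝒰 : NestedCovering C ι)
    (euc : InnerProductSpace.Core ℝ 𝒰.H1Real) {r : ℝ} (hr : r < 1)
    (hcov : ∀ x : C, ∃ j, x ∈ 𝒰.disc r j) :
    ∃ c : ℝ, 0 ≤ c ∧ ∀ (E : 𝒰.UnitaryFlatLineBundle) (g : ι → Circle) (s : ℝ), 0 ≤ s →
      (∀ (j k : ι) (x : C) (hj : x ∈ 𝒰.closedDisc r j) (hk : x ∈ 𝒰.closedDisc r k),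
        ‖((E.1 j k ⟨x, hj.1, hk.1⟩ : Circle) : ℂ) * (g k : ℂ) - (g j : ℂ)‖ ≤ s) →
      𝒰.euclideanDist euc 1 (QuotientGroup.mk E) ≤ c * s := by
  choose F hFK hF using 𝒰.exists_finset_overlap hr
  let P := Σ jk : ι × ι, {p // p ∈ F jk.1 jk.2}
  have : Fintype P := Fintype.ofFinite P
  -- Evaluation of cocycles at the points `P`.
  let ρ : 𝒰.Z1Real →ₗ[ℝ] (P → ℝ) :=
    { toFun := fun a p => a.1 p.1.1 p.1.2 p.2.1
      map_add' := fun _ _ => rfl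
      map_smul' := fun _ _ => rfl }
  have hρ : ∀ (a : 𝒰.Z1Real) (p : P), ρ a p = a.1 p.1.1 p.1.2 p.2.1 := fun _ _ => rfl
  have hval : ∀ (j k : ι) (x : C) (hj : x ∈ 𝒰.disc r j) (hk : x ∈ 𝒰.disc r k),
      ∃ p : P, ∀ a : 𝒰.Z1Real, a.1 j k ⟨x, hj.1, hk.1⟩ = ρ a p := fun j k x hj hk => by
    obtain ⟨p, hp, hpx⟩ := hF j k x (𝒰.disc_subset_closedDisc r j hj)
      (𝒰.disc_subset_closedDisc r k hk)
    exact ⟨⟨(j, k), p, hp⟩, fun a => hpx ℝ (a.1 j k)⟩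
  have hker : LinearMap.ker ρ ≤ LinearMap.ker 𝒰.B1Real.mkQ := fun a ha => by
    rw [Submodule.ker_mkQ]
    refine 𝒰.exists_coboundary_of_eq_zero hcov a.1 a.2 fun j k x hj hk => ?_
    obtain ⟨p, hp⟩ := hval j k x hj hk
    rw [hp a, LinearMap.mem_ker.1 ha]
    rfl
  have hint : ∀ (a : 𝒰.Z1Real) (n : P → ℤ), ρ a = (fun p => (n p : ℝ)) →
      𝒰.expZ1 a ∈ 𝒰.B1Unitary := fun a n hn => by
    refine 𝒰.exists_coboundary_of_eq_one hcov _ (𝒰.expZ1 a).2 fun j k x hj hk => ?_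
    obtain ⟨p, hp⟩ := hval j k x hj hk
    change expCircle (a.1 j k ⟨x, hj.1, hk.1⟩) = 1
    rw [hp a, hn, expCircle_intCast]
  have hspan : LinearMap.range ρ ≤ Submodule.span ℝ
      {w | w ∈ LinearMap.range ρ ∧ ∃ n : P → ℤ, w = fun p => (n p : ℝ)} := by
    rintro _ ⟨a, rfl⟩
    obtain ⟨d, β, μ, hμ, hsum⟩ := exists_integral_functionals (ρ a)
    have : ρ a = ∑ i, β i • ρ (𝒰.mapZ1 (μ i) a) := by
      funext p
      rw [Finset.sum_apply]
      exact hsum p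
    rw [this]
    refine Submodule.sum_mem _ fun i _ => Submodule.smul_mem _ _ (Submodule.subset_span ?_)
    choose n hn using hμ i
    exact ⟨⟨_, rfl⟩, n, funext hn⟩
  obtain ⟨T, hT⟩ := LinearMap.exists_comp_eq_of_ker_le_ker ρ 𝒰.B1Real.mkQ hker
  obtain ⟨c₁, hc₁, h₁⟩ := Submodule.exists_int_dist_le _ hspan
  obtain ⟨c₂, hc₂, h₂⟩ := euc.exists_bound T
  refine ⟨c₂ * c₁, by positivity, fun E g s hs hE => ?_⟩
  by_cases hlift : ∃ ξ, 𝒰.expH1 ξ = QuotientGroup.mk E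
  swap
  · -- If the class had no lift, the infimum would be over the empty set, hence zero.
    have : 𝒰.euclideanDist euc 1 (QuotientGroup.mk E) = 0 := by
      rw [euclideanDist, ← Real.sInf_empty]
      congr 1
      ext d
      simp only [mem_ofPred_eq, mem_empty_iff_false, iff_false]
      rintro ⟨_, ξ, -, h, -⟩
      exact hlift ⟨ξ, h⟩
    rw [this]
    positivity
  obtain ⟨ξ, hξ⟩ := hlift
  obtain ⟨a, rfl⟩ := Submodule.Quotient.mk_surjective _ ξ
  obtain ⟨t, ht⟩ := QuotientGroup.eq.1 ((𝒰.expH1_mk a).symm.trans hξ)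
  -- Absorb the change of frame into the real cocycle.
  let b : 𝒰.LC0 ℝ := fun j => (t j).map fun θ => Complex.arg (θ * g j : Circle) / (2 * Real.pi)
  have hb : ∀ (j k : ι) (x : C) (hj : x ∈ 𝒰.U j) (hk : x ∈ 𝒰.U k),
      expCircle ((a + 𝒰.deltaReal b).1 j k ⟨x, hj, hk⟩) =
        E.1 j k ⟨x, hj, hk⟩ * g k / g j := fun j k x hj hk => by
    have h := ht j k x hj hk
    change (expCircle (a.1 j k ⟨x, hj, hk⟩))⁻¹ * E.1 j k ⟨x, hj, hk⟩ = _ at h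
    have hE' : E.1 j k ⟨x, hj, hk⟩ =
        expCircle (a.1 j k ⟨x, hj, hk⟩) * (t k ⟨x, hk⟩ / t j ⟨x, hj⟩) := by
      rw [← h, mul_inv_cancel_left]
    change expCircle (a.1 j k ⟨x, hj, hk⟩ + (b k ⟨x, hk⟩ - b j ⟨x, hj⟩)) = _
    rw [expCircle_add, expCircle_sub, hE']
    change _ * (expCircle (Complex.arg (t k ⟨x, hk⟩ * g k : Circle) / (2 * Real.pi)) /
      expCircle (Complex.arg (t j ⟨x, hj⟩ * g j : Circle) / (2 * Real.pi))) = _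
    rw [expCircle_arg, expCircle_arg, mul_div_mul_comm, mul_assoc, mul_div_assoc, mul_div_assoc]
  choose n hn using fun p : P => exists_int_abs_sub_le (ρ (a + 𝒰.deltaReal b) p)
  have hclose : ‖ρ (a + 𝒰.deltaReal b) - fun p => (n p : ℝ)‖ ≤ s := by
    refine (pi_norm_le_iff_of_nonneg hs).2 fun p => (hn p).trans ?_
    have h1 := hFK _ _ p.2.1 p.2.2
    have h2 := hb p.1.1 p.1.2 p.2.1 h1.1.1 h1.2.1
    change ‖((expCircle (ρ (a + 𝒰.deltaReal b) p) : Circle) : ℂ) - 1‖ ≤ s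
    rw [hρ]
    erw [h2]
    refine le_trans (le_of_eq ?_) (hE p.1.1 p.1.2 p.2.1 h1.1 h1.2)
    rw [Circle.coe_div, Circle.coe_mul, div_sub_one (Circle.coe_ne_zero _), norm_div,
      Circle.norm_coe, div_one]
  -- Both `a'`, which lies over the trivial bundle, and `a`, which lies over `E`, are now compared.
  obtain ⟨m, ⟨a', ha'⟩, hm⟩ := h₁ _ (LinearMap.mem_range_self ρ (a + 𝒰.deltaReal b)) n
  have h1lift : 𝒰.expH1 (Submodule.Quotient.mk a') = 1 := by
    rw [expH1_mk, QuotientGroup.eq_one_iff]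
    exact hint a' m ha'
  have hdiff : (Submodule.Quotient.mk a' - Submodule.Quotient.mk a : 𝒰.H1Real) =
      T (ρ a' - ρ (a + 𝒰.deltaReal b)) := by
    rw [map_sub, hT, hT, map_add, (Submodule.Quotient.mk_eq_zero _).2 (𝒰.deltaReal_mem b) |>
      (show 𝒰.B1Real.mkQ (𝒰.deltaReal b) = 0 from ·), add_zero]
    rfl
  calc 𝒰.euclideanDist euc 1 (QuotientGroup.mk E)
      ≤ Real.sqrt (euc.inner (Submodule.Quotient.mk a' - Submodule.Quotient.mk a)
          (Submodule.Quotient.mk a' - Submodule.Quotient.mk a)) := by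
        refine csInf_le ⟨0, ?_⟩ ⟨_, _, h1lift, hξ, rfl⟩
        rintro _ ⟨_, _, -, -, rfl⟩
        exact Real.sqrt_nonneg _
    _ ≤ c₂ * ‖ρ a' - ρ (a + 𝒰.deltaReal b)‖ := by
        rw [hdiff]
        exact h₂ _
    _ ≤ c₂ * (c₁ * s) := by
        rw [norm_sub_rev, ha']
        gcongr
        exact hm.trans (by gcongr)
    _ = c₂ * c₁ * s := by ring

end NestedCovering

/-! ### Harnack estimates on discs of the plane -/

/-- The two-sided Harnack estimate at the centre of a disc, for a holomorphic function with values in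
the right half-plane: the Schwarz lemma applied to the Cayley transform
`(f - f 0) / (f + conj (f 0))`. -/
theorem Complex.norm_sub_le_mul_norm_add_conj {f : ℂ → ℂ} {R : ℝ}
    (hf : DifferentiableOn ℂ f (Metric.ball 0 R)) (hre : ∀ z ∈ Metric.ball (0 : ℂ) R, 0 < (f z).re)
    {z : ℂ} (hz : z ∈ Metric.ball (0 : ℂ) R) :
    ‖f z - f 0‖ ≤ ‖z‖ / R * ‖f z + (starRingEnd ℂ) (f 0)‖ := by
  have hR : 0 < R := Metric.nonempty_ball.1 ⟨z, hz⟩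
  have h0 : (0 : ℂ) ∈ Metric.ball (0 : ℂ) R := Metric.mem_ball_self hR
  have hne : ∀ w ∈ Metric.ball (0 : ℂ) R, f w + (starRingEnd ℂ) (f 0) ≠ 0 := fun w hw h => by
    have h' := congrArg Complex.re h
    simp only [Complex.add_re, Complex.conj_re, Complex.zero_re] at h'
    linarith [hre w hw, hre 0 h0]
  set G : ℂ → ℂ := fun w => (f w - f 0) / (f w + (starRingEnd ℂ) (f 0)) with hG
  have hG0 : G 0 = 0 := by simp [hG]
  have hd : DifferentiableOn ℂ G (Metric.ball 0 R) :=
    (hf.sub_const _).div (hf.add_const _) hne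
  have hmaps : MapsTo G (Metric.ball 0 R) (Metric.closedBall (G 0) 1) := fun w hw => by
    rw [hG0, mem_closedBall_zero_iff, hG, norm_div, div_le_one (norm_pos_iff.2 (hne w hw))]
    refine le_of_sq_le_sq ?_ (norm_nonneg _)
    rw [Complex.sq_norm, Complex.sq_norm, Complex.normSq_apply, Complex.normSq_apply]
    simp only [Complex.sub_re, Complex.sub_im, Complex.add_re, Complex.add_im, Complex.conj_re,
      Complex.conj_im]
    nlinarith [mul_pos (hre w hw) (hre 0 h0)]
  have h := Complex.dist_le_div_mul_dist_of_mapsTo_ball hd hmaps hz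
  rw [hG0, dist_zero_right, dist_zero_right, hG, norm_div, div_le_iff₀
    (norm_pos_iff.2 (hne z hz))] at h
  calc _ ≤ _ := h
    _ = _ := by ring

/-- Harnack's inequality for holomorphic functions `f` with positive real part on a disc: on a
compact concentric disc, the variation of `f` is bounded by the real part at any one point. -/
theorem Complex.exists_harnack {r R : ℝ} (hr : 0 < r) (hrR : r < R) :
    ∃ H : ℝ, 0 ≤ H ∧ ∀ f : ℂ → ℂ, DifferentiableOn ℂ f (Metric.ball 0 R) →
      (∀ z ∈ Metric.ball (0 : ℂ) R, 0 < (f z).re) →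
      ∀ z ∈ Metric.closedBall (0 : ℂ) r, ∀ w ∈ Metric.closedBall (0 : ℂ) r,
        ‖f z - f w‖ ≤ H * (f w).re := by
  have hR : 0 < R := hr.trans hrR
  set q := r / R with hq
  have hq0 : 0 < q := by positivity
  have hq1 : q < 1 := (div_lt_one hR).2 hrR
  have hq1' : 0 < 1 - q := by linarith
  set L := 2 * q / (1 - q) with hL
  have hL0 : 0 ≤ L := by positivity
  refine ⟨2 * L * ((1 + q) / (1 - q)), by positivity, fun f hf hre z hz w hw => ?_⟩
  have hsub := Metric.closedBall_subset_ball (x := (0 : ℂ)) hrR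
  set p := (f 0).re with hp
  have hp0 : 0 < p := hre 0 (Metric.mem_ball_self hR)
  have hbase : ∀ x ∈ Metric.closedBall (0 : ℂ) r,
      ‖f x - f 0‖ ≤ q * ‖f x + (starRingEnd ℂ) (f 0)‖ := fun x hx => by
    refine (Complex.norm_sub_le_mul_norm_add_conj hf hre (hsub hx)).trans ?_
    rw [hq]
    gcongr
    simpa using hx
  have hup : ∀ x ∈ Metric.closedBall (0 : ℂ) r, ‖f x - f 0‖ ≤ L * p := fun x hx => by
    have h1 := hbase x hx
    have h2 : ‖f x + (starRingEnd ℂ) (f 0)‖ ≤ ‖f x - f 0‖ + 2 * p := by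
      have h3 : f x + (starRingEnd ℂ) (f 0) = (f x - f 0) + ((2 * p : ℝ) : ℂ) := by
        rw [← Complex.add_conj]
        ring
      rw [h3]
      refine (norm_add_le _ _).trans ?_
      rw [Complex.norm_real, Real.norm_of_nonneg (by positivity)]
    rw [hL, div_mul_eq_mul_div, le_div_iff₀ hq1']
    nlinarith
  have hlow : p ≤ (1 + q) / (1 - q) * (f w).re := by
    have h1 := hbase w hw
    have h4 := hre w (hsub hw)
    -- Square the estimate and discard the imaginary parts.
    have h5 : |(f w).re - p| ≤ q * ((f w).re + p) := by
      have h6 : ‖f w - f 0‖ ^ 2 ≤ q ^ 2 * ‖f w + (starRingEnd ℂ) (f 0)‖ ^ 2 := by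
        rw [← mul_pow]
        gcongr
      rw [Complex.sq_norm, Complex.sq_norm, Complex.normSq_apply, Complex.normSq_apply] at h6
      simp only [Complex.sub_re, Complex.sub_im, Complex.add_re, Complex.add_im, Complex.conj_re,
        Complex.conj_im] at h6
      refine abs_le_of_sq_le_sq ?_ (by positivity)
      have h7 : 0 ≤ (1 - q ^ 2) * ((f w).im - (f 0).im) ^ 2 := by
        have : q ^ 2 ≤ 1 := by nlinarith
        exact mul_nonneg (by linarith) (sq_nonneg _)
      nlinarith
    have h8 := (abs_le.1 h5).1
    rw [div_mul_eq_mul_div, le_div_iff₀ hq1']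
    nlinarith
  calc ‖f z - f w‖ = ‖(f z - f 0) - (f w - f 0)‖ := by rw [sub_sub_sub_cancel_right]
    _ ≤ L * p + L * p := (norm_sub_le _ _).trans (add_le_add (hup z hz) (hup w hw))
    _ = 2 * L * p := by ring
    _ ≤ 2 * L * ((1 + q) / (1 - q) * (f w).re) := by gcongr
    _ = _ := by ring

/-- A holomorphic function on a disc, bounded by `M`, that almost attains the modulus `M` at a
point of a compact concentric disc is close to a constant of modulus `M` there. -/
theorem Complex.exists_norm_sub_const_le {r R : ℝ} (hr : 0 < r) (hrR : r < R) :
    ∃ H : ℝ, 0 ≤ H ∧ ∀ (g : ℂ → ℂ) (M ε : ℝ), DifferentiableOn ℂ g (Metric.ball 0 R) → 0 < ε →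
      (∀ z ∈ Metric.ball (0 : ℂ) R, ‖g z‖ ≤ M) →
      ∀ w ∈ Metric.closedBall (0 : ℂ) r, M - ε ≤ ‖g w‖ →
        ∃ c : Circle, ∀ z ∈ Metric.closedBall (0 : ℂ) r, ‖g z - M * c‖ ≤ H * ε := by
  obtain ⟨H, hH, hharnack⟩ := Complex.exists_harnack hr hrR
  refine ⟨2 * H + 1, by positivity, fun g M ε hg hε hM w hw hgw => ?_⟩
  have hsub := Metric.closedBall_subset_ball (x := (0 : ℂ)) hrR
  set c : Circle := Circle.exp (Complex.arg (g w)) with hc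
  have hcw : (‖g w‖ : ℂ) * c = g w := by
    rw [hc, Circle.coe_exp, Complex.norm_mul_exp_arg_mul_I]
  have hcc : (starRingEnd ℂ) (c : ℂ) * c = 1 := by
    rw [mul_comm, Complex.mul_conj, Circle.normSq_coe, Complex.ofReal_one]
  -- The margin `ε` makes the real part positive.
  set f : ℂ → ℂ := fun z => ((M + ε : ℝ) : ℂ) - (starRingEnd ℂ) (c : ℂ) * g z with hf
  have hnorm : ∀ z, ‖(starRingEnd ℂ) (c : ℂ) * g z‖ = ‖g z‖ := fun z => by
    rw [norm_mul, RCLike.norm_conj, Circle.norm_coe, one_mul]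
  have hfd : DifferentiableOn ℂ f (Metric.ball 0 R) := (hg.const_mul _).const_sub _
  have hre : ∀ z ∈ Metric.ball (0 : ℂ) R, 0 < (f z).re := fun z hz => by
    have h1 := (Complex.re_le_norm ((starRingEnd ℂ) (c : ℂ) * g z)).trans_eq (hnorm z)
    rw [hf, Complex.sub_re, Complex.ofReal_re]
    linarith [hM z hz]
  have hfw : f w = ((M + ε - ‖g w‖ : ℝ) : ℂ) := by
    rw [hf]
    simp only
    conv_lhs => rw [← hcw]
    rw [mul_left_comm, hcc]
    push_cast
    ring
  refine ⟨c, fun z hz => ?_⟩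
  have h := hharnack f hfd hre z hz w hw
  have h2 : ‖g z - g w‖ ≤ H * (2 * ε) := by
    have h3 : f z - f w = -((starRingEnd ℂ) (c : ℂ) * (g z - g w)) := by rw [hf]; ring
    rw [h3, norm_neg, norm_mul, RCLike.norm_conj, Circle.norm_coe, one_mul, hfw,
      Complex.ofReal_re] at h
    refine h.trans ?_
    gcongr
    linarith
  have h4 : ‖g w - M * c‖ ≤ ε := by
    have h5 : g w - M * c = ((‖g w‖ - M : ℝ) : ℂ) * c := by
      conv_lhs => rw [← hcw]
      push_cast
      ring
    rw [h5, norm_mul, Circle.norm_coe, mul_one, Complex.norm_real, Real.norm_eq_abs, abs_le]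
    constructor <;> linarith [hM w (hsub hw)]
  calc ‖g z - M * c‖ = ‖(g z - g w) + (g w - M * c)‖ := by rw [sub_add_sub_cancel]
    _ ≤ H * (2 * ε) + ε := (norm_add_le _ _).trans (add_le_add h2 h4)
    _ = (2 * H + 1) * ε := by ring

/-! ### Holomorphic cochains of nearly maximal modulus -/

namespace NestedCovering

variable {C : Type*} [TopologicalSpace C] [ChartedSpace ℂ C] {ι : Type*}

theorem differentiableOn_comp_symm [IsManifold 𝓘(ℂ) ω C] (𝒰 : NestedCovering C ι) {r : ℝ}
    (hr : r ≤ 1) {j : ι} {u : C → ℂ} (hu : MDifferentiableOn 𝓘(ℂ) 𝓘(ℂ) u (𝒰.disc r j)) :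
    DifferentiableOn ℂ (u ∘ (𝒰.φ j).symm) (Metric.ball 0 r) := by
  have hsub : Metric.ball (0 : ℂ) r ⊆ (𝒰.φ j).target := by
    rw [𝒰.target_eq]
    exact Metric.ball_subset_ball hr
  rw [← mdifferentiableOn_iff_differentiableOn]
  refine hu.comp (((contMDiffOn_symm_of_mem_maximalAtlas (𝒰.holomorphic j)).mdifferentiableOn
    (by simp)).mono hsub) fun z hz => ?_
  refine ⟨(𝒰.φ j).map_target (hsub hz), ?_⟩
  rw [(𝒰.φ j).right_inv (hsub hz)]
  simpa using hz

/-- `Complex.exists_norm_sub_const_le` in the coordinate discs. -/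
theorem exists_norm_sub_const_le [IsManifold 𝓘(ℂ) ω C] (𝒰 : NestedCovering C ι) {r R : ℝ}
    (hr : 0 < r) (hrR : r < R) (hR : R ≤ 1) :
    ∃ H : ℝ, 0 ≤ H ∧ ∀ (u : C → ℂ) (j : ι) (M ε : ℝ),
      MDifferentiableOn 𝓘(ℂ) 𝓘(ℂ) u (𝒰.disc R j) → 0 < ε → (∀ x ∈ 𝒰.disc R j, ‖u x‖ ≤ M) →
      ∀ x ∈ 𝒰.closedDisc r j, M - ε ≤ ‖u x‖ →
        ∃ c : Circle, ∀ y ∈ 𝒰.closedDisc r j, ‖u y - M * c‖ ≤ H * ε := by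
  obtain ⟨H, hH, h⟩ := Complex.exists_norm_sub_const_le hr hrR
  refine ⟨H, hH, fun u j M ε hu hε hM x hx hxM => ?_⟩
  have hball : ∀ y ∈ 𝒰.closedDisc r j, 𝒰.φ j y ∈ Metric.closedBall (0 : ℂ) r :=
    fun y hy => by simpa using hy.2
  have hinv : ∀ y ∈ 𝒰.closedDisc r j, (u ∘ (𝒰.φ j).symm) (𝒰.φ j y) = u y := fun y hy => by
    rw [Function.comp_apply, (𝒰.φ j).left_inv hy.1]
  obtain ⟨c, hc⟩ := h (u ∘ (𝒰.φ j).symm) M ε (𝒰.differentiableOn_comp_symm hR hu) hε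
    (fun z hz => by
      have hzt : z ∈ (𝒰.φ j).target := by
        rw [𝒰.target_eq]
        exact Metric.ball_subset_ball hR hz
      refine hM _ ⟨(𝒰.φ j).map_target hzt, ?_⟩
      rw [(𝒰.φ j).right_inv hzt]
      simpa using hz) _ (hball x hx) (by rwa [hinv x hx])
  exact ⟨c, fun y hy => by rw [← hinv y hy]; exact hc _ (hball y hy)⟩

/-- A cochain `u` bounded by `M` whose coboundary is bounded by `ε`, and which almost attains
the modulus `M`, is `O(ε)`-close to constants of modulus `M` on all the discs of a smaller
covering: near-maximality propagates along the connected nerve of the covering. -/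
theorem exists_norm_sub_frame_le [T2Space C] [ConnectedSpace C] [IsManifold 𝓘(ℂ) ω C] [Finite ι]
    (𝒰 : NestedCovering C ι) {r R : ℝ} (hr : 0 < r) (hrR : r < R) (hR : R ≤ 1)
    (hcov : ∀ x : C, ∃ j, x ∈ 𝒰.disc r j) :
    ∃ A : ℝ, 0 ≤ A ∧ ∀ (E : 𝒰.UnitaryFlatLineBundle) (u : ι → C → ℂ) (f : ι → ι → C → ℂ)
      (M ε : ℝ), 0 < ε → 𝒰.IsCochain0 R u → 𝒰.DeltaEq E R u f →
      (∀ j, ∀ x ∈ 𝒰.disc R j, ‖u j x‖ ≤ M) →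
      (∀ j k, ∀ x ∈ 𝒰.disc R j ∩ 𝒰.disc R k, ‖f j k x‖ ≤ ε) →
      (∃ j, ∃ x ∈ 𝒰.closedDisc r j, M - ε ≤ ‖u j x‖) →
      ∃ g : ι → Circle, ∀ j, ∀ x ∈ 𝒰.closedDisc r j, ‖u j x - M * g j‖ ≤ A * ε := by
  obtain ⟨H, hH, hloc⟩ := 𝒰.exists_norm_sub_const_le hr hrR hR
  -- For each pair of discs, near-maximality at the first implies it at the second, with a constant
  -- that depends only on the pair.
  have hchain : ∀ j₀ k : ι, ∃ B : ℝ, 0 < B ∧ ∀ (E : 𝒰.UnitaryFlatLineBundle) (u : ι → C → ℂ)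
      (f : ι → ι → C → ℂ) (M ε : ℝ), 0 < ε → 𝒰.IsCochain0 R u → 𝒰.DeltaEq E R u f →
      (∀ j, ∀ x ∈ 𝒰.disc R j, ‖u j x‖ ≤ M) →
      (∀ j k, ∀ x ∈ 𝒰.disc R j ∩ 𝒰.disc R k, ‖f j k x‖ ≤ ε) →
      (∃ x ∈ 𝒰.closedDisc r j₀, M - ε ≤ ‖u j₀ x‖) →
      ∃ x ∈ 𝒰.closedDisc r k, M - B * ε ≤ ‖u k x‖ := by
    intro j₀
    refine forall_of_closed_cover (K := 𝒰.closedDisc r)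
      (fun j => (𝒰.isCompact_closedDisc (hrR.trans_le hR) j).isClosed)
      (fun j => 𝒰.closedDisc_nonempty hr.le (hrR.trans_le hR) j)
      (fun x => (hcov x).imp fun j hj => 𝒰.disc_subset_closedDisc r j hj)
      (j₀ := j₀) ⟨1, one_pos, fun E u f M ε _ _ _ _ _ h => by rwa [one_mul]⟩ ?_
    rintro j ⟨B, hB, h⟩ l ⟨y, hyj, hyl⟩
    refine ⟨H * B + 1, by positivity, fun E u f M ε hε hu hδ hM hf h₀ => ?_⟩
    obtain ⟨x, hx, hxM⟩ := h E u f M ε hε hu hδ hM hf h₀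
    obtain ⟨c, hc⟩ := hloc (u j) j M (B * ε) (hu j) (by positivity) (hM j) x hx hxM
    refine ⟨y, hyl, ?_⟩
    have hyj' := 𝒰.closedDisc_subset_disc hrR j hyj
    have hyl' := 𝒰.closedDisc_subset_disc hrR l hyl
    have h1 := hδ j l y hyj' hyl'
    have h2 := hf j l y ⟨hyj', hyl'⟩
    rw [← h1] at h2
    have h3 : ‖u j y‖ - ‖u l y‖ ≤ ε := by
      have := norm_sub_norm_le (u j y) (((E.1 j l ⟨y, hyj'.1, hyl'.1⟩ : Circle) : ℂ) * u l y)
      rw [norm_mul, Circle.norm_coe, one_mul, norm_sub_rev] at this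
      exact this.trans h2
    have h4 : M - ‖u j y‖ ≤ H * (B * ε) := by
      have h5 := norm_sub_norm_le ((M : ℂ) * c) (u j y)
      rw [norm_mul, Circle.norm_coe, mul_one, Complex.norm_real, norm_sub_rev] at h5
      linarith [hc y hyj, Real.le_norm_self M]
    linarith
  choose B hB hprop using hchain
  obtain ⟨b, hb⟩ := (finite_range fun p : ι × ι => B p.1 p.2).bddAbove
  refine ⟨H * max b 0, by positivity, fun E u f M ε hε hu hδ hM hf ⟨j₀, h₀⟩ => ?_⟩
  have hall : ∀ k, ∃ c : Circle, ∀ y ∈ 𝒰.closedDisc r k, ‖u k y - M * c‖ ≤ H * max b 0 * ε := by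
    intro k
    obtain ⟨x, hx, hxM⟩ := hprop j₀ k E u f M ε hε hu hδ hM hf h₀
    obtain ⟨c, hc⟩ := hloc (u k) k M (B j₀ k * ε) (hu k) (mul_pos (hB _ _) hε) (hM k) x hx hxM
    refine ⟨c, fun y hy => (hc y hy).trans ?_⟩
    have : B j₀ k ≤ max b 0 := (hb ⟨(j₀, k), rfl⟩).trans (le_max_left _ _)
    rw [mul_assoc]
    gcongr
  exact Classical.skolem.1 hall

/-- The modulus of a holomorphic cochain attains its maximum over the closed discs of a smaller
radius. -/
theorem exists_max_norm [Nonempty ι] [Finite ι] (𝒰 : NestedCovering C ι) {r s : ℝ} (hr : 0 ≤ r)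
    (hrs : r < s) (hs : s ≤ 1) {u : ι → C → ℂ} (hu : 𝒰.IsCochain0 s u) :
    ∃ j, ∃ x ∈ 𝒰.closedDisc r j, ∀ k, ∀ y ∈ 𝒰.closedDisc r k, ‖u k y‖ ≤ ‖u j x‖ := by
  have h : ∀ j, ∃ x ∈ 𝒰.closedDisc r j, ∀ y ∈ 𝒰.closedDisc r j, ‖u j y‖ ≤ ‖u j x‖ := fun j =>
    (𝒰.isCompact_closedDisc (hrs.trans_le hs) j).exists_isMaxOn
      (𝒰.closedDisc_nonempty hr (hrs.trans_le hs) j)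
      (((hu j).continuousOn.mono (𝒰.closedDisc_subset_disc hrs j)).norm)
  choose x hx hmax using h
  obtain ⟨j, hj⟩ := Finite.exists_max fun j => ‖u j (x j)‖
  exact ⟨j, x j, hx j, fun k y hy => (hmax k y hy).trans (hj k)⟩

/-- The estimate for real `ε`: a coboundary `δ u` bounded by `ε` on `U ^ {r₁}` controls
`d(1, E) |u|` on `U ^ {r₂}`. -/
theorem exists_euclideanDist_mul_norm_le [T2Space C] [CompactSpace C] [ConnectedSpace C]
    [IsManifold 𝓘(ℂ) ω C] [Finite ι] (𝒰 : NestedCovering C ι)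
    (euc : InnerProductSpace.Core ℝ 𝒰.H1Real) :
    ∃ D : ℝ, 0 < D ∧ ∀ (E : 𝒰.UnitaryFlatLineBundle) (r₁ r₂ : ℝ), 𝒰.rStar < r₂ → r₂ < r₁ →
      r₁ ≤ 1 → ∀ (u : ι → C → ℂ) (f : ι → ι → C → ℂ) (ε : ℝ), 0 < ε →
      0 ≤ 𝒰.euclideanDist euc 1 (QuotientGroup.mk E) →
      𝒰.IsCochain0 r₁ u → 𝒰.DeltaEq E r₁ u f →
      (∀ j k, ∀ x ∈ 𝒰.disc r₁ j ∩ 𝒰.disc r₁ k, ‖f j k x‖ ≤ ε) →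
      ∀ j, ∀ x ∈ 𝒰.disc r₂ j,
        𝒰.euclideanDist euc 1 (QuotientGroup.mk E) * ‖u j x‖ ≤ D * ε := by
  obtain ⟨r, hr, hrR, hcov⟩ := 𝒰.exists_radius_lt_covers
  have : Nonempty ι := ⟨(hcov (Classical.arbitrary C)).choose⟩
  obtain ⟨c, hc, hdist⟩ := 𝒰.exists_euclideanDist_le euc (hrR.trans 𝒰.rStar_lt_one) hcov
  obtain ⟨A, hA, hframe⟩ := 𝒰.exists_norm_sub_frame_le hr hrR 𝒰.rStar_lt_one.le hcov
  refine ⟨c * (1 + 2 * A) + c * 2 + 1, by positivity,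
    fun E r₁ r₂ hr₂ hr₁₂ hr₁ u f ε hε hd₀ hu hδ hf j x hx => ?_⟩
  have hR₁ : 𝒰.rStar < r₁ := hr₂.trans hr₁₂
  set d := 𝒰.euclideanDist euc 1 (QuotientGroup.mk E) with hd
  -- The distance is bounded: all transition functions are `2`-close to `1`.
  have hd₂ : d ≤ c * 2 := hdist E (fun _ => 1) 2 zero_le_two fun j k x hj hk => by
    refine (norm_sub_le _ _).trans ?_
    rw [norm_mul, Circle.norm_coe, Circle.norm_coe]
    norm_num
  have hshift : ∀ j k x, x ∈ 𝒰.disc r₁ j → x ∈ 𝒰.disc r₁ k → ‖u j x‖ ≤ ‖u k x‖ + ε := by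
    intro j k x hj hk
    have h1 := hf j k x ⟨hj, hk⟩
    rw [← hδ j k x hj hk] at h1
    have h2 := norm_sub_norm_le (u j x) (((E.1 j k ⟨x, hj.1, hk.1⟩ : Circle) : ℂ) * u k x)
    rw [norm_mul, Circle.norm_coe, one_mul, norm_sub_rev] at h2
    linarith
  obtain ⟨j₀, x₀, hx₀, hmax⟩ := 𝒰.exists_max_norm 𝒰.rStar_pos.le hR₁ hr₁ hu
  set M := ‖u j₀ x₀‖ with hM
  have hM₀ : 0 ≤ M := norm_nonneg _
  -- The maximum is attained on a disc of radius `rStar`, hence almost attained on one of radius `r`.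
  obtain ⟨k, hk⟩ := hcov x₀
  obtain ⟨g, hg⟩ := hframe E u f M ε hε (fun j => (hu j).mono (𝒰.disc_mono hR₁.le j))
    (fun j k x hj hk => hδ j k x (𝒰.disc_mono hR₁.le j hj) (𝒰.disc_mono hR₁.le k hk))
    (fun j x hx => hmax j x (𝒰.disc_subset_closedDisc _ j hx))
    (fun j k x hx => hf j k x ⟨𝒰.disc_mono hR₁.le j hx.1, 𝒰.disc_mono hR₁.le k hx.2⟩)
    ⟨k, x₀, 𝒰.disc_subset_closedDisc r k hk, by
      have := hshift j₀ k x₀ (𝒰.closedDisc_subset_disc hR₁ j₀ hx₀)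
        (𝒰.disc_mono (hrR.trans hR₁).le k hk)
      linarith⟩
  have hdM : d * M ≤ c * (1 + 2 * A) * ε := by
    rcases hM₀.eq_or_lt with h0 | hMpos
    · rw [← h0, mul_zero]
      positivity
    have h := hdist E g ((1 + 2 * A) * ε / M) (by positivity) fun j k x hj hk => by
      have hj' := 𝒰.closedDisc_subset_disc (hrR.trans hR₁) j hj
      have hk' := 𝒰.closedDisc_subset_disc (hrR.trans hR₁) k hk
      rw [le_div_iff₀ hMpos]
      set t := ((E.1 j k ⟨x, hj.1, hk.1⟩ : Circle) : ℂ) with ht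
      have h1 := hf j k x ⟨hj', hk'⟩
      rw [← hδ j k x hj' hk', ← ht] at h1
      have hscale : ‖t * (g k : ℂ) - g j‖ * M = ‖M * (t * (g k : ℂ) - g j)‖ := by
        rw [norm_mul, Complex.norm_real, Real.norm_of_nonneg hM₀, mul_comm]
      have hsplit : (M : ℂ) * (t * g k - g j) =
          (t * u k x - u j x) - t * (u k x - M * g k) + (u j x - M * g j) := by ring
      have h2 : ‖t * (u k x - M * g k)‖ ≤ A * ε := by
        rw [norm_mul, ht, Circle.norm_coe, one_mul]
        exact hg k x hk
      rw [hscale, hsplit]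
      refine (norm_add_le _ _).trans ?_
      linarith [norm_sub_le (t * u k x - u j x) (t * (u k x - M * g k)), hg j x hj]
    calc d * M ≤ c * ((1 + 2 * A) * ε / M) * M := by gcongr
      _ = c * (1 + 2 * A) * ε := by field_simp
  obtain ⟨l, hl⟩ := hcov x
  have hux : ‖u j x‖ ≤ M + ε := by
    refine (hshift j l x (𝒰.disc_mono hr₁₂.le j hx) (𝒰.disc_mono (hrR.trans hR₁).le l hl)).trans ?_
    have := hmax l x (𝒰.disc_subset_closedDisc _ l (𝒰.disc_mono hrR.le l hl))
    linarith
  calc d * ‖u j x‖ ≤ d * (M + ε) := by gcongr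
    _ = d * M + d * ε := by ring
    _ ≤ c * (1 + 2 * A) * ε + c * 2 * ε := by gcongr
    _ ≤ _ := by nlinarith

end NestedCovering

theorem mainTheorem10 {C : Type*} [TopologicalSpace C] [T2Space C] [CompactSpace C]
    [ConnectedSpace C] [ChartedSpace ℂ C] [IsManifold 𝓘(ℂ) ω C]
    {ι : Type*} [Finite ι] (𝒰 : NestedCovering C ι)
    (euc : InnerProductSpace.Core ℝ 𝒰.H1Real) :
    ∃ D : ℝ, 0 < D ∧
      ∀ (E : 𝒰.UnitaryFlatLineBundle) (r₁ r₂ : ℝ), 𝒰.rStar < r₂ → r₂ < r₁ → r₁ ≤ 1 →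
        ∀ f : ι → ι → C → ℂ, 𝒰.IsCoboundary E r₁ f →
          ∃ v : ι → C → ℂ, 𝒰.IsCochain0 r₂ v ∧ 𝒰.DeltaEq E r₂ v f ∧
            𝒰.supNorm0 r₂ v ≤
              ENNReal.ofReal D /
                ENNReal.ofReal ((r₁ - r₂) ^ 2 * 𝒰.euclideanDist euc 1 (QuotientGroup.mk E)) *
                  𝒰.supNorm1 r₁ f := by
  obtain ⟨D, hD, hmain⟩ := 𝒰.exists_euclideanDist_mul_norm_le euc
  refine ⟨D, hD, fun E r₁ r₂ hr₂ hr₁₂ hr₁ f ⟨u, hu, hδ⟩ => ?_⟩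
  have hle : ∀ j k, ∀ x ∈ 𝒰.disc r₁ j ∩ 𝒰.disc r₁ k, ‖f j k x‖ₑ ≤ 𝒰.supNorm1 r₁ f :=
    fun j k x hx => le_iSup_of_le j (le_iSup_of_le k (le_iSup₂_of_le x hx le_rfl))
  -- For `f = 0` the zero cochain is needed: the right-hand side vanishes even if `d(1, E) = 0`.
  by_cases hf0 : 𝒰.supNorm1 r₁ f = 0
  · refine ⟨fun _ _ => 0, fun j => mdifferentiableOn_const, fun j k x hj hk => ?_, ?_⟩
    · have := hle j k x ⟨𝒰.disc_mono hr₁₂.le j hj, 𝒰.disc_mono hr₁₂.le k hk⟩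
      rw [hf0, nonpos_iff_eq_zero, enorm_eq_zero] at this
      rw [this, mul_zero, sub_zero]
    · simp [NestedCovering.supNorm0]
  refine ⟨u, fun j => (hu j).mono (𝒰.disc_mono hr₁₂.le j),
    fun j k x hj hk => hδ j k x (𝒰.disc_mono hr₁₂.le j hj) (𝒰.disc_mono hr₁₂.le k hk), ?_⟩
  set d := 𝒰.euclideanDist euc 1 (QuotientGroup.mk E) with hd
  have hρ : 0 < (r₁ - r₂) ^ 2 := pow_pos (sub_pos.2 hr₁₂) 2
  have hD' : ENNReal.ofReal D ≠ 0 := by simpa using hD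
  -- For `f ≠ 0` the right-hand side is infinite if `d(1, E) = 0` or `f` is unbounded.
  rcases le_or_gt d 0 with hd0 | hd0
  · rw [ENNReal.ofReal_of_nonpos (mul_nonpos_of_nonneg_of_nonpos hρ.le hd0),
      ENNReal.div_zero hD', ENNReal.top_mul hf0]
    exact le_top
  by_cases hftop : 𝒰.supNorm1 r₁ f = ⊤
  · rw [hftop, ENNReal.mul_top (ENNReal.div_ne_zero.2 ⟨hD', ENNReal.ofReal_ne_top⟩)]
    exact le_top
  set ε := (𝒰.supNorm1 r₁ f).toReal with hε
  have hε0 : 0 < ε := ENNReal.toReal_pos hf0 hftop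
  have hbound := hmain E r₁ r₂ hr₂ hr₁₂ hr₁ u f ε hε0 hd0.le hu hδ fun j k x hx => by
    rw [← toReal_enorm]
    exact ENNReal.toReal_mono hftop (hle j k x hx)
  rw [← ENNReal.ofReal_div_of_pos (by positivity), ← ENNReal.ofReal_toReal hftop, ← hε,
    ← ENNReal.ofReal_mul (by positivity)]
  refine iSup_le fun j => iSup₂_le fun x hx => ?_
  rw [← ofReal_norm]
  refine ENNReal.ofReal_le_ofReal ?_
  have h1 : (r₁ - r₂) ^ 2 ≤ 1 := by
    have := 𝒰.rStar_pos
    exact pow_le_one₀ (by linarith) (by linarith)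
  rw [div_mul_eq_mul_div, le_div_iff₀ (by positivity)]
  calc ‖u j x‖ * ((r₁ - r₂) ^ 2 * d) ≤ ‖u j x‖ * (1 * d) := by gcongr
    _ = d * ‖u j x‖ := by ring
    _ ≤ D * ε := hbound j x hx
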